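/- \textbf{Definitions.} For integers $q\ge 0$ and $k\ge 1$, the Kneser graph $\mathrm{Kn}(q,k)$ is the graph whose vertices are the $k$-element subsets of $[q]=\{1,\dots,q\}$, two vertices being adjacent if and only if they are disjoint. The chromatic polynomial $\chi_G(n)$ of a finite graph $G$ is the polynomial in $n$ whose value at each $n\in\mathbb N=\{0,1,2,\dots\}$ is the number of proper colorings of the vertices of $G$ with $n$ colors. A \emph{numerical polynomial} is a polynomial $g\in\mathbb Q[x]$ with $g(q)\in\mathbb Z$ for every $q\in\mathbb Z$. Let $g$ be a numerical polynomial with $g(q)\ge 0$ for all sufficiently large $q$, let $S=\{q\in\mathbb N: g(q)\ge 0\}$, and let $e:S\to\mathbb N\cup\{-1,\infty\}$. A \emph{two-level polynomial of degree $g$ and depth $e$} is a sequence $(f_q)_{q\in S}$ of polynomials $f_q\in\mathbb Q[n]$, with $f_q$ of degree $g(q)$, such that, writing \[ f_q(n)=\sum_{r=0}^{\infty}c_r(q)\,n^{g(q)-r},\qquad c_r(q)=0 \text{ for } r>g(q), \] there are polynomials $\phi_0,\phi_1,\phi_2,\dots\in\mathbb Q[x]$ with $c_r(q)=\phi_r(q)$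 for every $q\in S$ and every integer $r$ with $0\le r\le e(q)$. For $q\in\mathbb N\setminus S$ one sets $f_q=0$ and $e(q)=-1$. The two-level polynomial has \emph{infinite depth} if $e(q)=\infty$ for all $q\in S$, that is, $c_r(q)=\phi_r(q)$ for all $q\in S$ and all $r\ge 0$ (including $r>g(q)$). \textbf{Theorem.} Fix $k\ge 1$. Then $f_q(n)=\chi_{\mathrm{Kn}(q,k)}(n)$, $q\in\mathbb N$, is a two-level polynomial of degree $\binom{q}{k}$ and infinite depth. Here the degree is the numerical polynomial $g(x)=\frac{x(x-1)\cdots(x-k+1)}{k!}$, for which $S=\mathbb N$. -/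

import Mathlib

namespace TwoLevel

open Polynomial

/-- A numerical polynomial: a rational polynomial taking integer values at all integers. -/
def IsNumerical (g : ℚ[X]) : Prop :=
  ∀ q : ℤ, ∃ m : ℤ, g.eval (q : ℚ) = (m : ℚ)

/-- The codegree `r` coefficient of `p`: if `p` has degree `d`, this is the coefficient of
the power `d - r` of the variable when `r ≤ d`, and `0` when `r > d`. -/
noncomputable def codegreeCoeff (p : ℚ[X]) (r : ℕ) : ℚ :=
  if r ≤ p.natDegree then p.coeff (p.natDegree - r) else 0

/-- `f` is a two-level polynomial of degree `g` and depth `e`.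
The index set is `S = {q ∈ ℕ : g(q) ≥ 0}`, and the sequence is extended to all of `ℕ` by
`f q = 0`, `e q = -1` for `q ∉ S`. The values of the depth function lie in `ℕ ∪ {-1, ∞}`,
which is `WithBot ℕ∞`, with `⊥` in the role of `-1` and `⊤` in the role of `∞`. -/
structure IsTwoLevelPolynomial (g : ℚ[X]) (e : ℕ → WithBot ℕ∞) (f : ℕ → ℚ[X]) : Prop where
  numerical : IsNumerical g
  eventually_nonneg : ∀ᶠ q : ℕ in Filter.atTop, 0 ≤ g.eval (q : ℚ)
  /-- For `q ∈ S`, the polynomial `f q` is nonzero of degree exactly `g(q)`. -/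
  degree_eq : ∀ q : ℕ, 0 ≤ g.eval (q : ℚ) →
    f q ≠ 0 ∧ ((f q).natDegree : ℚ) = g.eval (q : ℚ)
  /-- Up to the depth, the codegree `r` coefficients agree with one polynomial in `q`. -/
  coeff_eq : ∃ φ : ℕ → ℚ[X], ∀ q : ℕ, 0 ≤ g.eval (q : ℚ) →
    ∀ r : ℕ, ((r : ℕ∞) : WithBot ℕ∞) ≤ e q → codegreeCoeff (f q) r = (φ r).eval (q : ℚ)
  eq_zero_of_neg : ∀ q : ℕ, g.eval (q : ℚ) < 0 → f q = 0
  depth_of_neg : ∀ q : ℕ, g.eval (q : ℚ) < 0 → e q = ⊥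

/-- The polynomial `x (x - 1) ⋯ (x - k + 1) / k!`. -/
noncomputable def binomialPolynomial (k : ℕ) : ℚ[X] :=
  C ((k.factorial : ℚ)⁻¹) * descPochhammer ℚ k

theorem binomialPolynomial_eval (k q : ℕ) :
    (binomialPolynomial k).eval (q : ℚ) = (q.choose k : ℚ) := by
  have hk : (k.factorial : ℚ) ≠ 0 := by exact_mod_cast k.factorial_ne_zero
  rw [binomialPolynomial, eval_mul, eval_C, descPochhammer_eval_eq_descFactorial,
    Nat.descFactorial_eq_factorial_mul_choose, Nat.cast_mul, inv_mul_cancel_left₀ hk]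

/-- The Kneser graph on the `k`-subsets of a `q`-element set, adjacency being disjointness.
(The requirement that adjacent vertices be distinct is automatic for `k ≥ 1`.) -/
def kneserGraph (q k : ℕ) : SimpleGraph {s : Finset (Fin q) // s.card = k} where
  Adj s t := s ≠ t ∧ Disjoint s.1 t.1
  symm := ⟨fun _ _ h => ⟨h.1.symm, h.2.symm⟩⟩
  loopless := ⟨fun _ h => h.1 rfl⟩

theorem kneserGraph_adj {q k : ℕ} (hk : 1 ≤ k) (s t : {s : Finset (Fin q) // s.card = k}) :
    (kneserGraph q k).Adj s t ↔ Disjoint s.1 t.1 := by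
  refine ⟨fun h => h.2, fun h => ⟨?_, h⟩⟩
  rintro rfl
  have h0 : s.1 = ∅ := by simpa using h
  have h1 := s.2
  rw [h0, Finset.card_empty] at h1
  omega

/-- `p` is the chromatic polynomial of `G`: for every natural number `n`, its value at `n` is
the number of proper colorings of the vertices of `G` with `n` colors. -/
def IsChromaticPolynomial {V : Type*} (G : SimpleGraph V) (p : ℚ[X]) : Prop :=
  ∀ n : ℕ, p.eval (n : ℚ) = (Nat.card (G.Coloring (Fin n)) : ℚ)

/-- A graph has at most one chromatic polynomial. -/
theorem IsChromaticPolynomial.unique {V : Type*} {G : SimpleGraph V} {p p' : ℚ[X]}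
    (h : IsChromaticPolynomial G p) (h' : IsChromaticPolynomial G p') : p = p' :=
  Polynomial.eq_of_infinite_eval_eq p p'
    ((Set.infinite_range_of_injective (Nat.cast_injective (R := ℚ))).mono
      (by rintro _ ⟨n, rfl⟩; exact (h n).trans (h' n).symm))

end TwoLevel

namespace TwoLevel

open Polynomial Finset

/-! Inclusion-exclusion over sets `A` of disjoint pairs (`card_separating`) writes the chromatic
polynomial as a sum of `(-1)^#A * n^c(A)`, where `c(A)` counts the classes generated by `A`. Edges
occur as ordered pairs, each in both orders; repeating a condition does no harm to
inclusion-exclusion. The codegree `r` coefficient is thus the signed count of the `A` of corank `r`.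

Such an `A` involves at most `2r` vertices, hence covers at most `2rk` points of the ground set
(`coveringSum_eq_zero`). Grouped by the covered set `W`, the signed count depends only on `#W`
(`sum_groundSet_eq`), since isolated vertices do not change the corank. The coefficient is therefore
a combination of `q.choose j` for `j ≤ 2rk`, with weights independent of `q`: a polynomial in `q`.
-/

/-- The number of classes of the equivalence relation on `V` generated by the pairs in `A`. -/
noncomputable def componentCount {V : Type*} (A : Finset (V × V)) : ℕ :=
  Nat.card (Quot fun u v => (u, v) ∈ A)

/-! ### Classes generated by a set of pairs -/

section Components

variable {V V' : Type*}

theorem componentCount_le [Fintype V] (A : Finset (V × V)) :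
    componentCount A ≤ Fintype.card V := by
  rw [← Nat.card_eq_fintype_card]
  exact Nat.card_le_card_of_surjective (Quot.mk _) Quot.mk_surjective

theorem componentCount_empty [Fintype V] :
    componentCount (∅ : Finset (V × V)) = Fintype.card V := by
  rw [← Nat.card_eq_fintype_card]
  refine (Nat.card_congr (Equiv.ofBijective (Quot.mk _) ⟨fun u v h => ?_, Quot.mk_surjective⟩)).symm
  exact congrArg (Quot.lift id (fun a b hab => absurd hab (Finset.notMem_empty _))) h

/-- Maps that are constant on every pair in `A` are the maps from the set of classes. -/
theorem card_constant_on [Fintype V] [DecidableEq V] (A : Finset (V × V)) (n : ℕ) :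
    #{c : V → Fin n | ∀ p ∈ A, c p.1 = c p.2} = n ^ componentCount A := by
  have e : {c : V → Fin n // ∀ p ∈ A, c p.1 = c p.2} ≃
      ((Quot fun u v => (u, v) ∈ A) → Fin n) :=
    { toFun := fun c => Quot.lift c.1 fun u v h => c.2 (u, v) h
      invFun := fun d => ⟨fun v => d (Quot.mk _ v), fun p hp => congrArg d (Quot.sound hp)⟩
      left_inv := fun c => rfl
      right_inv := fun d => by
        funext x
        induction x using Quot.ind
        rfl }
  rw [← Fintype.card_subtype, ← Nat.card_eq_fintype_card, Nat.card_congr e, Nat.card_fun,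
    Nat.card_fin, componentCount]

/-- Inclusion-exclusion for the number of maps separating every pair in `E`. -/
theorem card_separating [Fintype V] [DecidableEq V] (E : Finset (V × V)) (n : ℕ) :
    (#{c : V → Fin n | ∀ p ∈ E, c p.1 ≠ c p.2} : ℚ) =
      ∑ A ∈ E.powerset, (-1) ^ #A * (n : ℚ) ^ componentCount A := by
  have hprod (c : V → Fin n) : (if ∀ p ∈ E, c p.1 ≠ c p.2 then (1 : ℚ) else 0) =
      ∑ A ∈ E.powerset, (-1) ^ #A * (if ∀ p ∈ A, c p.1 = c p.2 then (1 : ℚ) else 0) := by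
    have h1 : (if ∀ p ∈ E, c p.1 ≠ c p.2 then (1 : ℚ) else 0) =
        ∏ p ∈ E, (1 + -(if c p.1 = c p.2 then (1 : ℚ) else 0)) := by
      rw [Finset.prod_congr rfl (g := fun p => if c p.1 ≠ c p.2 then (1 : ℚ) else 0)
        fun p _ => by split_ifs <;> simp_all, Finset.prod_ite_zero, Finset.prod_const_one]
      congr
    rw [h1, Finset.prod_one_add]
    refine Finset.sum_congr rfl fun A _ => ?_
    rw [Finset.prod_neg, Finset.prod_ite_zero, Finset.prod_const_one]
    congr
  rw [Finset.natCast_card_filter, Finset.sum_congr rfl fun c _ => hprod c, Finset.sum_comm]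
  refine Finset.sum_congr rfl fun A _ => ?_
  rw [← Finset.mul_sum, ← Finset.natCast_card_filter, card_constant_on, Nat.cast_pow]

/-- Adding isolated points to `V` increases the number of classes by the number of these points. -/
theorem componentCount_map [Fintype V] [Fintype V'] (f : V ↪ V') (A : Finset (V × V)) :
    componentCount (A.map (f.prodMap f)) + Fintype.card V =
      componentCount A + Fintype.card V' := by
  classical
  let r : V → V → Prop := fun u v => (u, v) ∈ A
  let r' : V' → V' → Prop := fun u v => (u, v) ∈ A.map (f.prodMap f)
  let fwd : V' → Quot r ⊕ {x : V' // x ∉ Set.range f} := fun x =>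
    if h : x ∈ Set.range f then Sum.inl (Quot.mk r h.choose) else Sum.inr ⟨x, h⟩
  have hf (v : V) : fwd (f v) = Sum.inl (Quot.mk r v) := by
    have h : f v ∈ Set.range f := ⟨v, rfl⟩
    simp only [fwd, dif_pos h]
    rw [f.injective h.choose_spec]
  have hn (x : {x : V' // x ∉ Set.range f}) : fwd x = Sum.inr x := dif_neg x.2
  have hr (u v : V') (h : r' u v) : fwd u = fwd v := by
    obtain ⟨⟨a, b⟩, hab, h2⟩ := Finset.mem_map.1 h
    obtain ⟨rfl, rfl⟩ := Prod.mk.inj h2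
    rw [hf, hf]
    exact congrArg Sum.inl (Quot.sound hab)
  let e : Quot r' ≃ Quot r ⊕ {x : V' // x ∉ Set.range f} :=
    { toFun := Quot.lift fwd hr
      invFun := Sum.elim
        (Quot.lift (fun v => Quot.mk r' (f v)) fun u v h =>
          Quot.sound (Finset.mem_map.2 ⟨(u, v), h, rfl⟩))
        (fun x => Quot.mk r' x)
      left_inv := fun x => by
        induction x using Quot.ind with | mk x => ?_
        by_cases h : x ∈ Set.range f
        · obtain ⟨v, rfl⟩ := h
          change Sum.elim _ _ (fwd (f v)) = _
          rw [hf]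
          rfl
        · change Sum.elim _ _ (fwd x) = _
          rw [hn ⟨x, h⟩]
          rfl
      right_inv := fun y => by
        rcases y with y | y
        · induction y using Quot.ind with | mk v => exact hf v
        · exact hn y }
  have h1 : componentCount (A.map (f.prodMap f)) =
      componentCount A + Nat.card {x : V' // x ∉ Set.range f} := by
    rw [componentCount, Nat.card_congr e, Nat.card_sum]
    rfl
  have h2 : Fintype.card V + Nat.card {x : V' // x ∉ Set.range f} = Fintype.card V' := by
    rw [← Nat.card_eq_fintype_card, ← Nat.card_eq_fintype_card,
      ← Nat.card_congr (Equiv.sumCompl fun x => x ∈ Set.range f), Nat.card_sum,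
      Nat.card_congr (Equiv.ofInjective f f.injective)]
  omega

/-- The points occurring in some pair of `A`. -/
def endpoints [DecidableEq V] (A : Finset (V × V)) : Finset V :=
  A.image Prod.fst ∪ A.image Prod.snd

/-- Give endpoints weight 1 and all other points weight 2. Every class weighs at least 2: a class
with an endpoint has a second element, because pairs in `A` are off the diagonal. Consequently
corank `r` allows at most `2r` endpoints. -/
theorem two_mul_componentCount_add_card_endpoints_le [Fintype V] [DecidableEq V]
    (A : Finset (V × V)) (hA : ∀ p ∈ A, p.1 ≠ p.2) :
    2 * componentCount A + #(endpoints A) ≤ 2 * Fintype.card V := by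
  classical
  have := Fintype.ofFinite (Quot fun u v => (u, v) ∈ A)
  let π : V → Quot fun u v => (u, v) ∈ A := Quot.mk _
  have key (y : Quot fun u v => (u, v) ∈ A) :
      2 ≤ ∑ v with π v = y, (1 + if v ∈ endpoints A then 0 else 1) := by
    induction y using Quot.ind with | mk v => ?_
    by_cases hv : v ∈ endpoints A
    · obtain ⟨w, hw, hvw⟩ : ∃ w, w ≠ v ∧ π w = π v := by
        rcases Finset.mem_union.1 hv with h | h
        · obtain ⟨p, hp, rfl⟩ := Finset.mem_image.1 h
          exact ⟨p.2, (hA p hp).symm, (Quot.sound hp).symm⟩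
        · obtain ⟨p, hp, rfl⟩ := Finset.mem_image.1 h
          exact ⟨p.1, hA p hp, Quot.sound hp⟩
      calc 2 = #{w, v} := (Finset.card_pair hw).symm
        _ ≤ #{u | π u = π v} := Finset.card_le_card fun u hu => by
            rcases Finset.mem_insert.1 hu with rfl | hu
            · simpa using hvw
            · simp [Finset.mem_singleton.1 hu]
        _ = ∑ u with π u = π v, 1 := Finset.card_eq_sum_ones _
        _ ≤ _ := Finset.sum_le_sum fun u _ => Nat.le_add_right _ _
    · calc 2 = 1 + if v ∈ endpoints A then 0 else 1 := by rw [if_neg hv]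
        _ ≤ _ := Finset.single_le_sum (f := fun u => 1 + if u ∈ endpoints A then 0 else 1)
            (fun _ _ => Nat.zero_le _) (by simp [π])
  have h1 : 2 * componentCount A ≤ ∑ v, (1 + if v ∈ endpoints A then 0 else 1) := by
    rw [← Finset.sum_fiberwise Finset.univ π]
    calc 2 * componentCount A = ∑ _y : Quot fun u v => (u, v) ∈ A, 2 := by
          rw [Finset.sum_const, Finset.card_univ, ← Nat.card_eq_fintype_card, smul_eq_mul,
            mul_comm, componentCount]
      _ ≤ _ := Finset.sum_le_sum fun y _ => key y
  have h2 : ∑ v, (1 + if v ∈ endpoints A then 0 else 1) + #(endpoints A) =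
      2 * Fintype.card V := by
    have h3 : #(endpoints A) = ∑ v, if v ∈ endpoints A then 1 else 0 := by simp
    rw [h3, ← Finset.sum_add_distrib,
      Finset.sum_congr rfl (g := fun _ => 2) fun v _ => by split_ifs <;> rfl]
    simp [mul_comm]
  omega

end Components

/-! ### Sets of disjoint pairs and the points they cover -/

section Kneser

variable {q k : ℕ}

/-- The vertices of the Kneser graph. -/
abbrev KneserVertex (q k : ℕ) : Type := {s : Finset (Fin q) // #s = k}

theorem card_kneserVertex (q k : ℕ) : Fintype.card (KneserVertex q k) = q.choose k := by
  simp

/-- The ordered pairs of disjoint `k`-subsets. -/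
def disjointPairs (q k : ℕ) : Finset (KneserVertex q k × KneserVertex q k) :=
  {p | Disjoint p.1.1 p.2.1}

theorem mem_disjointPairs {p : KneserVertex q k × KneserVertex q k} :
    p ∈ disjointPairs q k ↔ Disjoint p.1.1 p.2.1 := by
  simp [disjointPairs]

theorem ne_of_mem_disjointPairs (hk : 1 ≤ k) {p : KneserVertex q k × KneserVertex q k}
    (hp : p ∈ disjointPairs q k) : p.1 ≠ p.2 :=
  ((kneserGraph_adj hk p.1 p.2).2 (mem_disjointPairs.1 hp)).1

/-- The union of all the subsets occurring in a set of pairs. -/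
def groundSet (A : Finset (KneserVertex q k × KneserVertex q k)) : Finset (Fin q) :=
  A.biUnion fun p => p.1.1 ∪ p.2.1

theorem card_groundSet_le (A : Finset (KneserVertex q k × KneserVertex q k)) :
    #(groundSet A) ≤ #(endpoints A) * k := by
  have h : groundSet A ⊆ (endpoints A).biUnion Subtype.val := by
    intro x hx
    obtain ⟨p, hp, hx⟩ := Finset.mem_biUnion.1 hx
    rcases Finset.mem_union.1 hx with hx | hx
    · exact Finset.mem_biUnion.2
        ⟨p.1, Finset.mem_union_left _ (Finset.mem_image_of_mem _ hp), hx⟩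
    · exact Finset.mem_biUnion.2
        ⟨p.2, Finset.mem_union_right _ (Finset.mem_image_of_mem _ hp), hx⟩
  exact (Finset.card_le_card h).trans
    (Finset.card_biUnion_le_card_mul _ _ _ fun s _ => s.2.le)

/-- The map on `k`-subsets induced by an injection. -/
def kneserEmbedding {j : ℕ} (k : ℕ) (e : Fin j ↪ Fin q) : KneserVertex j k ↪ KneserVertex q k where
  toFun s := ⟨s.1.map e, by rw [Finset.card_map, s.2]⟩
  inj' s t h := Subtype.ext (Finset.map_injective e (congrArg Subtype.val h))

/-- The sets of disjoint pairs of corank `r`. -/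
noncomputable def pairSets (q k r : ℕ) : Finset (Finset (KneserVertex q k × KneserVertex q k)) :=
  {A ∈ (disjointPairs q k).powerset | componentCount A + r = q.choose k}

theorem mem_pairSets {r : ℕ} {A : Finset (KneserVertex q k × KneserVertex q k)} :
    A ∈ pairSets q k r ↔ A ⊆ disjointPairs q k ∧ componentCount A + r = q.choose k := by
  simp [pairSets]

/-- Enlarging the ground set only adds isolated vertices, so the class count and the vertex count
grow equally. -/
theorem map_mem_pairSets_iff {j r : ℕ} (e : Fin j ↪ Fin q)
    (A : Finset (KneserVertex j k × KneserVertex j k)) :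
    A.map ((kneserEmbedding k e).prodMap (kneserEmbedding k e)) ∈ pairSets q k r ↔
      A ∈ pairSets j k r := by
  have h := componentCount_map (kneserEmbedding k e) A
  rw [card_kneserVertex, card_kneserVertex] at h
  rw [mem_pairSets, mem_pairSets]
  refine and_congr ?_ (by omega)
  constructor
  · intro hA p hp
    have := mem_disjointPairs.1 (hA (Finset.mem_map_of_mem
      ((kneserEmbedding k e).prodMap (kneserEmbedding k e)) hp))
    exact mem_disjointPairs.2 ((Finset.disjoint_map e).1 this)
  · intro hA p hp
    obtain ⟨s, hs, rfl⟩ := Finset.mem_map.1 hp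
    exact mem_disjointPairs.2 ((Finset.disjoint_map e).2 (mem_disjointPairs.1 (hA hs)))

theorem groundSet_map {j : ℕ} (e : Fin j ↪ Fin q)
    (A : Finset (KneserVertex j k × KneserVertex j k)) :
    groundSet (A.map ((kneserEmbedding k e).prodMap (kneserEmbedding k e))) =
      (groundSet A).map e := by
  ext x
  simp only [groundSet, Finset.mem_biUnion, Finset.mem_map, Finset.mem_union]
  constructor
  · rintro ⟨_, ⟨p, hp, rfl⟩, hx⟩
    rcases hx with hx | hx
    · obtain ⟨y, hy, rfl⟩ := Finset.mem_map.1 hx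
      exact ⟨y, ⟨p, hp, Or.inl hy⟩, rfl⟩
    · obtain ⟨y, hy, rfl⟩ := Finset.mem_map.1 hx
      exact ⟨y, ⟨p, hp, Or.inr hy⟩, rfl⟩
  · rintro ⟨y, ⟨p, hp, hy⟩, rfl⟩
    exact ⟨_, ⟨p, hp, rfl⟩, hy.imp (Finset.mem_map_of_mem e) (Finset.mem_map_of_mem e)⟩

/-- The signed number of sets of disjoint pairs of corank `r` that cover `Fin j`. -/
noncomputable def coveringSum (k r j : ℕ) : ℚ :=
  ∑ A ∈ pairSets j k r with groundSet A = Finset.univ, (-1) ^ #A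

theorem mem_range_kneserEmbedding {j : ℕ} {e : Fin j ↪ Fin q} {s : KneserVertex q k}
    (h : s.1 ⊆ Finset.univ.map e) : ∃ t, kneserEmbedding k e t = s := by
  obtain ⟨t, -, ht⟩ := Finset.subset_map_iff.1 h
  refine ⟨⟨t, ?_⟩, Subtype.ext ht.symm⟩
  rw [← Finset.card_map e, ← ht, s.2]

/-- Transport along the increasing enumeration of `W` preserves corank, cardinality and covering. -/
theorem sum_groundSet_eq (r : ℕ) (W : Finset (Fin q)) :
    ∑ A ∈ pairSets q k r with groundSet A = W, (-1 : ℚ) ^ #A = coveringSum k r #W := by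
  classical
  let e : Fin #W ↪ Fin q := (W.orderEmbOfFin rfl).toEmbedding
  have he : Finset.univ.map e = W := Finset.map_orderEmbOfFin_univ W rfl
  let F := (kneserEmbedding k e).prodMap (kneserEmbedding k e)
  have hmem (A : Finset (KneserVertex #W k × KneserVertex #W k)) :
      A.map F ∈ (pairSets q k r).filter (fun A => groundSet A = W) ↔
        A ∈ (pairSets #W k r).filter (fun A => groundSet A = Finset.univ) := by
    rw [Finset.mem_filter, Finset.mem_filter, map_mem_pairSets_iff, groundSet_map]
    refine and_congr_right fun _ => ?_
    have h := (Finset.map_injective e).eq_iff (a := groundSet A) (b := Finset.univ)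
    rwa [he] at h
  refine (Finset.sum_bij (fun A _ => A.map F) (fun A hA => (hmem A).2 hA)
    (fun A _ B _ h => Finset.map_injective F h) (fun B hB => ?_)
    fun A _ => by rw [Finset.card_map]).symm
  have hB' : ∃ A : Finset (KneserVertex #W k × KneserVertex #W k), A.map F = B := by
    -- Both members of a pair in `B` lie inside `W`, so they are images of `k`-subsets of `Fin #W`.
    have hsub : B ⊆ Finset.univ.map F := fun p hp => by
      have hW : p.1.1 ∪ p.2.1 ⊆ Finset.univ.map e := by
        rw [he, ← (Finset.mem_filter.1 hB).2]
        exact Finset.subset_biUnion_of_mem (fun p => p.1.1 ∪ p.2.1) hp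
      obtain ⟨s, hs⟩ := mem_range_kneserEmbedding (Finset.union_subset_left hW)
      obtain ⟨t, ht⟩ := mem_range_kneserEmbedding (Finset.union_subset_right hW)
      exact Finset.mem_map.2 ⟨(s, t), Finset.mem_univ _, Prod.ext hs ht⟩
    obtain ⟨A, -, hA⟩ := Finset.subset_map_iff.1 hsub
    exact ⟨A, hA.symm⟩
  obtain ⟨A, rfl⟩ := hB'
  exact ⟨A, (hmem A).1 hB, rfl⟩

theorem coveringSum_eq_zero (hk : 1 ≤ k) {r j : ℕ} (h : 2 * r * k < j) :
    coveringSum k r j = 0 := by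
  refine Finset.sum_eq_zero fun A hA => ?_
  obtain ⟨hA, hu⟩ := Finset.mem_filter.1 hA
  obtain ⟨hE, hc⟩ := mem_pairSets.1 hA
  have h1 := two_mul_componentCount_add_card_endpoints_le A
    fun p hp => ne_of_mem_disjointPairs hk (hE hp)
  rw [card_kneserVertex] at h1
  have h2 := card_groundSet_le A
  rw [hu, Finset.card_univ, Fintype.card_fin] at h2
  have h3 : #(endpoints A) * k ≤ 2 * r * k := Nat.mul_le_mul_right k (by omega)
  omega

theorem sum_pairSets (hk : 1 ≤ k) (q r : ℕ) :
    ∑ A ∈ pairSets q k r, (-1 : ℚ) ^ #A =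
      ∑ j ∈ Finset.range (2 * r * k + 1), coveringSum k r j * (q.choose j : ℚ) := by
  have h1 : ∑ A ∈ pairSets q k r, (-1 : ℚ) ^ #A =
      ∑ j ∈ Finset.range (q + 1), coveringSum k r j * (q.choose j : ℚ) := by
    rw [← Finset.sum_fiberwise (pairSets q k r) groundSet,
      Finset.sum_congr rfl fun W _ => sum_groundSet_eq r W, ← Finset.powerset_univ,
      Finset.sum_powerset_apply_card, Finset.card_univ, Fintype.card_fin]
    exact Finset.sum_congr rfl fun j _ => by rw [nsmul_eq_mul, mul_comm]
  -- Both ranges are extended to a common one: beyond `q` the binomials vanish, beyond `2rk` the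
  -- covering sums do.
  have h2 (N : ℕ) (hN : N ≤ max (q + 1) (2 * r * k + 1))
      (hz : ∀ j, N ≤ j → coveringSum k r j * (q.choose j : ℚ) = 0) :
      ∑ j ∈ Finset.range N, coveringSum k r j * (q.choose j : ℚ) =
        ∑ j ∈ Finset.range (max (q + 1) (2 * r * k + 1)),
          coveringSum k r j * (q.choose j : ℚ) :=
    Finset.sum_subset (Finset.range_subset_range.2 hN) fun j _ hj =>
      hz j (by simpa using hj)
  rw [h1, h2 (q + 1) (le_max_left _ _) fun j hj => by
      rw [Nat.choose_eq_zero_of_lt hj, Nat.cast_zero, mul_zero],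
    h2 (2 * r * k + 1) (le_max_right _ _) fun j hj => by
      rw [coveringSum_eq_zero hk hj, zero_mul]]

/-! ### The chromatic polynomial and its coefficients -/

/-- The chromatic polynomial of the Kneser graph. -/
noncomputable def kneserPolynomial (k q : ℕ) : ℚ[X] :=
  ∑ A ∈ (disjointPairs q k).powerset, C ((-1) ^ #A) * X ^ componentCount A

theorem isChromaticPolynomial_kneserPolynomial (hk : 1 ≤ k) (q : ℕ) :
    IsChromaticPolynomial (kneserGraph q k) (kneserPolynomial k q) := by
  intro n
  have e : (kneserGraph q k).Coloring (Fin n) ≃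
      {c : KneserVertex q k → Fin n // ∀ p ∈ disjointPairs q k, c p.1 ≠ c p.2} :=
    { toFun := fun c => ⟨c, fun p hp =>
        c.valid ((kneserGraph_adj hk p.1 p.2).2 (mem_disjointPairs.1 hp))⟩
      invFun := fun c => SimpleGraph.Coloring.mk c.1 fun {u v} h =>
        c.2 (u, v) (mem_disjointPairs.2 h.2)
      left_inv := fun c => rfl
      right_inv := fun c => rfl }
  rw [Nat.card_congr e, Nat.card_eq_fintype_card, Fintype.card_subtype, card_separating,
    kneserPolynomial, eval_finsetSum]
  simp

theorem coeff_kneserPolynomial {q m r : ℕ} (h : m + r = q.choose k) :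
    (kneserPolynomial k q).coeff m = ∑ A ∈ pairSets q k r, (-1 : ℚ) ^ #A := by
  rw [kneserPolynomial, finsetSum_coeff, pairSets, Finset.sum_filter]
  refine Finset.sum_congr rfl fun A _ => ?_
  rw [coeff_C_mul_X_pow]
  exact if_congr (by omega) rfl rfl

theorem pairSets_zero (hk : 1 ≤ k) (q : ℕ) : pairSets q k 0 = {∅} := by
  ext A
  rw [mem_pairSets, Finset.mem_singleton]
  constructor
  · rintro ⟨hE, hc⟩
    have h1 := two_mul_componentCount_add_card_endpoints_le A
      fun p hp => ne_of_mem_disjointPairs hk (hE hp)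
    rw [card_kneserVertex] at h1
    have h2 : endpoints A = ∅ := Finset.card_eq_zero.1 (by omega)
    exact Finset.image_eq_empty.1 (Finset.union_eq_empty.1 h2).1
  · rintro rfl
    exact ⟨Finset.empty_subset _, by rw [componentCount_empty, card_kneserVertex, add_zero]⟩

theorem coeff_choose_kneserPolynomial (hk : 1 ≤ k) (q : ℕ) :
    (kneserPolynomial k q).coeff (q.choose k) = 1 := by
  rw [coeff_kneserPolynomial (r := 0) (add_zero _), pairSets_zero hk]
  simp

theorem natDegree_kneserPolynomial (hk : 1 ≤ k) (q : ℕ) :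
    (kneserPolynomial k q).natDegree = q.choose k := by
  refine natDegree_eq_of_le_of_coeff_ne_zero ?_ ?_
  · refine natDegree_sum_le_of_forall_le _ _ fun A _ => (natDegree_C_mul_X_pow_le _ _).trans ?_
    exact (componentCount_le A).trans (card_kneserVertex q k).le
  · rw [coeff_choose_kneserPolynomial hk]
    exact one_ne_zero

theorem codegreeCoeff_kneserPolynomial (hk : 1 ≤ k) (q r : ℕ) :
    codegreeCoeff (kneserPolynomial k q) r = ∑ A ∈ pairSets q k r, (-1 : ℚ) ^ #A := by
  rw [codegreeCoeff, natDegree_kneserPolynomial hk]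
  split_ifs with h
  · exact coeff_kneserPolynomial (Nat.sub_add_cancel h)
  -- No set has corank exceeding the number of vertices, so the formula also gives 0 past the
  -- degree; this makes the depth infinite.
  · refine (Finset.sum_eq_zero fun A hA => ?_).symm
    have := (mem_pairSets.1 hA).2
    omega

end Kneser

theorem isNumerical_binomialPolynomial (k : ℕ) : IsNumerical (binomialPolynomial k) := by
  intro q
  -- `Ring.choose` also covers negative `q`.
  refine ⟨Ring.choose q k, ?_⟩
  have hk : (k.factorial : ℚ) ≠ 0 := by exact_mod_cast k.factorial_ne_zero
  have h := Ring.descPochhammer_eq_factorial_smul_choose q k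
  rw [← eval_eq_smeval, nsmul_eq_mul] at h
  rw [binomialPolynomial, eval_mul, eval_C, ← descPochhammer_map (Int.castRingHom ℚ) k,
    ← eq_intCast (Int.castRingHom ℚ) q, eval_map_apply, h, map_mul, map_natCast,
    inv_mul_cancel_left₀ hk, eq_intCast]

end TwoLevel

open TwoLevel in
theorem mainTheorem2 (k : ℕ) (hk : 1 ≤ k) :
    ∃ f : ℕ → Polynomial ℚ,
      (∀ q : ℕ, TwoLevel.IsChromaticPolynomial (TwoLevel.kneserGraph q k) (f q)) ∧
      TwoLevel.IsTwoLevelPolynomial (TwoLevel.binomialPolynomial k) (fun _ => ⊤) f := by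
  have hnonneg (q : ℕ) : 0 ≤ (binomialPolynomial k).eval (q : ℚ) := by
    rw [binomialPolynomial_eval]
    exact Nat.cast_nonneg _
  refine ⟨kneserPolynomial k, isChromaticPolynomial_kneserPolynomial hk,
    isNumerical_binomialPolynomial k, Filter.Eventually.of_forall hnonneg, fun q _ => ⟨?_, ?_⟩,
    ⟨fun r => ∑ j ∈ Finset.range (2 * r * k + 1),
      Polynomial.C (coveringSum k r j) * binomialPolynomial j, fun q _ r _ => ?_⟩,
    fun q h => absurd h (hnonneg q).not_gt, fun q h => absurd h (hnonneg q).not_gt⟩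
  · intro h
    have := coeff_choose_kneserPolynomial hk q
    rw [h, Polynomial.coeff_zero] at this
    exact zero_ne_one this
  · rw [natDegree_kneserPolynomial hk, binomialPolynomial_eval]
  · rw [codegreeCoeff_kneserPolynomial hk, sum_pairSets hk, Polynomial.eval_finsetSum]
    refine Finset.sum_congr rfl fun j _ => ?_
    rw [Polynomial.eval_mul, Polynomial.eval_C, binomialPolynomial_eval]
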